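/- Theorem 1.5. Let $A$ be a commutative Henselian Noetherian local ring and let $\mathcal K=K^b(\operatorname{proj}A)$ be the homotopy category of bounded cochain complexes of finitely generated projective (equivalently, free) $A$-modules, with its usual triangulated structure and shift $[1]$. A triangle $U\xrightarrow{f}K\xrightarrow{g}X\xrightarrow{h}U[1]$ in $\mathcal K$ is called a right AR-triangle (ending at $X$) if $X$ and $U$ are indecomposable, $h\neq0$, and $h\circ t=0$ for every indecomposable $D\in\mathcal K$ and every non-isomorphism $t\colon D\to X$. A triangle $X[-1]\xrightarrow{w}U\xrightarrow{f}K\xrightarrow{g}X$ in $\mathcal K$ is called a left AR-triangle (starting at $U$) if $X$ and $U$ are indecomposable, $w\neq0$, and $t\circ w=0$ for every indecomposable $D\in\mathcal K$ and every non-isomorphism $t\colon U\to D$. For $Y\in\mathcal K$ write $H^*(Y)=\bigoplus_{i\in\mathbb Z}H^i(Y)$. (1) If $X[-1]\xrightarrow{w}U\xrightarrow{f}K\xrightarrow{g}X$ is a left AR-triangle in $\mathcal K$, then the $A$-modules $H^*(X)$, $H^*(U)$ and $H^*(K)$ have finite length. (2) If $U\xrightarrow{f}K\xrightarrow{g}X\xrightarrow{h}U[1]$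 is a right AR-triangle in $\mathcal K$, then the $A$-modules $H^*(X)$, $H^*(U)$ and $H^*(K)$ have finite length. -/

import Mathlib

open CategoryTheory Limits Pretriangulated
open scoped ZeroObject

universe u v

namespace ARTriangles

section Triangulated

variable {C : Type u} [Category.{v} C] [Preadditive C] [HasZeroObject C] [HasShift C ℤ]
  [∀ n : ℤ, (shiftFunctor C n).Additive] [Pretriangulated C]

/-- The triangle `N ⟶ E ⟶ M ⟶ N⟦1⟧` is a right Auslander-Reiten triangle (ending at `M`). -/
structure IsRightARTriangle {N E M : C} (f : N ⟶ E) (g : E ⟶ M) (h : M ⟶ N⟦(1 : ℤ)⟧) :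
    Prop where
  distinguished : Triangle.mk f g h ∈ distTriang C
  indecomposable_right : Indecomposable M
  indecomposable_left : Indecomposable N
  ne_zero : h ≠ 0
  comp_eq_zero : ∀ (D : C), Indecomposable D → ∀ t : D ⟶ M, ¬ IsIso t → t ≫ h = 0

/-- The triangle `M⟦-1⟧ ⟶ N ⟶ E ⟶ M` is a left Auslander-Reiten triangle (starting at `N`).
In the underlying distinguished triangle, `M` is identified with `M⟦-1⟧⟦1⟧` by the canonical
isomorphism. -/
structure IsLeftARTriangle {M N E : C} (w : M⟦(-1 : ℤ)⟧ ⟶ N) (f : N ⟶ E) (g : E ⟶ M) :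
    Prop where
  distinguished : Triangle.mk w f (g ≫ (shiftNegShift M (1 : ℤ)).inv) ∈ distTriang C
  indecomposable_right : Indecomposable M
  indecomposable_left : Indecomposable N
  ne_zero : w ≠ 0
  comp_eq_zero : ∀ (D : C), Indecomposable D → ∀ t : N ⟶ D, ¬ IsIso t → w ≫ t = 0

end Triangulated

section Perfect

variable (A : Type u) [CommRing A]

/-- A cochain complex of `A`-modules is a bounded complex of finitely generated projectives if
all its terms are finitely generated projective modules (over a local ring: finitely generated
free modules) and they vanish outside a bounded range of degrees. -/
def boundedProjComplex : ObjectProperty (CochainComplex (ModuleCat.{u} A) ℤ) := fun K =>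
  (∃ a b : ℤ, K.IsStrictlyGE a ∧ K.IsStrictlyLE b) ∧
    ∀ i : ℤ, Module.Finite A (K.X i) ∧ Module.Projective A (K.X i)

/-- The objects of the homotopy category of `A`-modules whose underlying cochain complex is a
bounded complex of finitely generated projectives. -/
def boundedProj : ObjectProperty (HomotopyCategory (ModuleCat.{u} A) (.up ℤ)) := fun X =>
  boundedProjComplex A X.as

variable {A}

theorem boundedProj_quotient_obj_iff (K : CochainComplex (ModuleCat.{u} A) ℤ) :
    boundedProj A ((HomotopyCategory.quotient _ _).obj K) ↔ boundedProjComplex A K := Iff.rfl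

theorem boundedProjComplex_zero : boundedProjComplex A 0 := by
  refine ⟨⟨0, 0, inferInstance, inferInstance⟩, fun i => ?_⟩
  have hz : IsZero ((0 : CochainComplex (ModuleCat.{u} A) ℤ).X i) :=
    (HomologicalComplex.eval _ _ i).map_isZero (isZero_zero _)
  have := ModuleCat.subsingleton_of_isZero hz
  exact ⟨inferInstance, inferInstance⟩

theorem boundedProjComplex_shift (K : CochainComplex (ModuleCat.{u} A) ℤ)
    (hK : boundedProjComplex A K) (n : ℤ) : boundedProjComplex A (K⟦n⟧) := by
  obtain ⟨⟨a, b, _, _⟩, h⟩ := hK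
  exact ⟨⟨a - n, b - n, K.isStrictlyGE_shift a n (a - n) (by lia),
    K.isStrictlyLE_shift b n (b - n) (by lia)⟩, fun i => h (i + n)⟩

theorem boundedProjComplex_mappingCone {K L : CochainComplex (ModuleCat.{u} A) ℤ} (f : K ⟶ L)
    (hK : boundedProjComplex A K) (hL : boundedProjComplex A L) :
    boundedProjComplex A (CochainComplex.mappingCone f) := by
  obtain ⟨⟨a, b, _, _⟩, hK⟩ := hK
  obtain ⟨⟨a', b', _, _⟩, hL⟩ := hL
  refine ⟨⟨min (a - 1) a', max (b - 1) b',
    CochainComplex.isStrictlyGE_mappingCone f a a' _ (by simp) (by simp), ?_⟩, fun i => ?_⟩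
  · rw [CochainComplex.isStrictlyLE_iff]
    intro i hi
    rw [CochainComplex.mappingCone.isZero_X_iff]
    exact ⟨K.isZero_of_isStrictlyLE b _ (by lia), L.isZero_of_isStrictlyLE b' _ (by lia)⟩
  · have e : (CochainComplex.mappingCone f).X i ≃ₗ[A] (K.X (i + 1) × L.X i) :=
      ((HomologicalComplex.homotopyCofiber.XIsoBiprod f i (i + 1) rfl) ≪≫
        ModuleCat.biprodIsoProd _ _).toLinearEquiv
    obtain ⟨_, _⟩ := hK (i + 1)
    obtain ⟨_, _⟩ := hL i
    exact ⟨Module.Finite.equiv e.symm, Module.Projective.of_equiv e.symm⟩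

instance : (boundedProj A).ContainsZero where
  exists_zero :=
    ⟨(HomotopyCategory.quotient _ _).obj 0, Functor.map_isZero _ (isZero_zero _),
      boundedProjComplex_zero⟩

instance : (boundedProj A).IsStableUnderShift ℤ where
  isStableUnderShiftBy n :=
    { le_shift := fun X hX => by
        obtain ⟨K, rfl⟩ := X.quotient_obj_surjective
        rw [ObjectProperty.prop_shift_iff, HomotopyCategory.shift_quotient_obj]
        exact boundedProjComplex_shift K hX n }

instance : (boundedProj A).IsTriangulatedClosed₃ where
  ext₃' T hT h₁ h₂ := by
    obtain ⟨f : T.obj₁.as ⟶ T.obj₂.as, hf⟩ := (HomotopyCategory.quotient _ _).map_surjective T.mor₁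
    refine ⟨_, ?_,
      ⟨Triangle.π₃.mapIso (isoTriangleOfIso₁₂ T _ hT
        (HomotopyCategory.mappingCone_triangleh_distinguished f)
        (Iso.refl _) (Iso.refl _) ?_)⟩⟩
    · exact boundedProjComplex_mappingCone f h₁ h₂
    · exact (Category.comp_id _).trans (hf.symm.trans (Category.id_comp _).symm)

instance : (boundedProj A).IsTriangulated where
  toIsTriangulatedClosed₂ := .of_isTriangulatedClosed₃

variable (A)

/-- The bounded homotopy category `K^b(proj A)` of finitely generated projective `A`-modules,
with the triangulated structure induced from the homotopy category of `A`-modules. -/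
abbrev Kb := (boundedProj A).FullSubcategory

variable {A}

/-- The `i`-th cohomology module of an object of `K^b(proj A)`. -/
noncomputable abbrev cohomology (X : Kb A) (i : ℤ) : ModuleCat.{u} A :=
  (HomotopyCategory.homologyFunctor (ModuleCat.{u} A) (.up ℤ) i).obj X.obj

/-- The total cohomology `H^*(X) = ⨁ i, H^i(X)` is an `A`-module of finite length. -/
def HasFiniteLengthCohomology (X : Kb A) : Prop :=
  IsFiniteLength A (DirectSum ℤ fun i => cohomology X i)

end Perfect

end ARTriangles

/-! A right AR-triangle carries a nonzero `h : X ⟶ V` with `V = U⟦1⟧`, killed by every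
non-isomorphism from an indecomposable to `X`; a left one carries a morphism with the dual property.
Hom modules in `Kb A` are finite over a Noetherian local ring, so by Krull's intersection theorem,
for each `r` in the maximal ideal some `r ^ n` does not divide `h`.

Complete `r ^ n` on `X` to a triangle with a map `t : D ⟶ X`. Then `t ≫ h ≠ 0`, so `t` has a section
(`exists_section_of_comp_ne_zero`), and `r ^ n` vanishes on `X`. At `V` the hypothesis gives no such
splitting directly; there locality of `End V` replaces it (`isIso_or_isIso_id_sub`). This is where
the Henselian property enters, through lifting coprime factorizations of polynomials.

Hence each `r` acts nilpotently on `X`, `U` and the middle term, and so on their cohomology, which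
is a finite module and therefore has finite length. -/

namespace ARTriangles

/-! ### Lifting factorizations and idempotents over a Henselian local ring. -/

section Henselian

open Polynomial IsLocalRing

/-- A residue field valued point of an étale algebra over a Henselian local ring lifts to a
section. -/
theorem exists_algHom_of_etale {A : Type u} [CommRing A] [HenselianLocalRing A]
    {S : Type v} [CommRing S] [Algebra A S] [Algebra.Etale A S]
    (φ : S →ₐ[A] ResidueField A) :
    ∃ σ : S →ₐ[A] A, (Algebra.ofId A (ResidueField A)).comp σ = φ := by
  have hQ : (RingHom.ker φ).IsPrime := RingHom.ker_isPrime _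
  have : Algebra.IsEtaleAt A (RingHom.ker φ) := inferInstance
  obtain ⟨f, hf, hst⟩ := Algebra.IsEtaleAt.exists_isStandardEtale (R := A) (RingHom.ker φ)
  obtain ⟨P⟩ := hst.nonempty_standardEtalePresentation
  let φ' : Localization.Away f →ₐ[A] ResidueField A :=
    IsLocalization.Away.liftAlgHom f (f := φ) (by simpa using hf)
  have hφ' : φ'.comp (IsScalarTower.toAlgHom A S (Localization.Away f)) = φ := by
    ext x; simp [φ']
  have hm := P.hasMap.map φ'
  have hroot : ∀ p : A[X], p.Monic → ∀ a₀ : ResidueField A, aeval a₀ p = 0 →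
      aeval a₀ (derivative p) ≠ 0 → ∃ a : A, p.IsRoot a ∧ residue A a = a₀ :=
    ((HenselianLocalRing.TFAE A).out 0 1 rfl rfl).mp ‹_›
  -- In a standard étale algebra the derivative of `P.f` is invertible at `P.x`, so the residue
  -- point is a simple root and Hensel's lemma lifts it.
  obtain ⟨a, ha, hax⟩ := hroot P.f P.monic_f (φ' P.x) hm.1 hm.isUnit_derivative_f.ne_zero
  have hma : P.HasMap a := by
    refine ⟨by simpa [coe_aeval_eq_eval] using ha, ?_⟩
    have h2 := hm.2
    rw [← hax, ← ResidueField.algebraMap_eq, aeval_algebraMap_apply,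
      ResidueField.algebraMap_eq] at h2
    exact (isUnit_map_iff (residue A) _).mp h2
  let σ' : Localization.Away f →ₐ[A] A := (P.lift a hma).comp P.equivRing.toAlgHom
  have hσ' : (Algebra.ofId A (ResidueField A)).comp σ' = φ' := by
    apply P.hom_ext
    simp [σ', Algebra.ofId_apply, ← hax]
  exact ⟨σ'.comp (IsScalarTower.toAlgHom A S (Localization.Away f)), by
    rw [← AlgHom.comp_assoc, hσ', hφ']⟩

/-- Over a Henselian local ring, a factorization of the reduction of a monic polynomial into
coprime monic factors lifts. -/
theorem exists_factorization_of_henselian {A : Type u} [CommRing A] [HenselianLocalRing A]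
    (p : A[X]) (hp : p.Monic) (f g : (ResidueField A)[X]) (hf : f.Monic) (hg : g.Monic)
    (H : p.map (residue A) = f * g) (hfg : IsCoprime f g) :
    ∃ f' g' : A[X], p = f' * g' ∧ IsCoprime f' g' ∧ f'.map (residue A) = f ∧
      g'.map (residue A) = g := by
  have hn : p.natDegree = f.natDegree + g.natDegree := by
    simpa [hf.natDegree_mul hg, hp.natDegree_map] using congr(($H).natDegree)
  -- The étale algebra representing coprime monic factorizations of `p` in these degrees; the
  -- factorization over the residue field is one of its points.
  let E (S : Type u) [CommRing S] [Algebra A S] := UniversalCoprimeFactorizationRing.homEquiv S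
    f.natDegree g.natDegree hn (.mk p hp rfl)
  let φ := (E (ResidueField A)).symm ⟨(.mk f hf rfl, .mk g hg rfl), H.symm, hfg⟩
  obtain ⟨σ, hσ⟩ := exists_algHom_of_etale φ
  refine ⟨(E A σ).1.1.1, (E A σ).1.2.1, ?_, (E A σ).2.2, ?_, ?_⟩
  · simpa using (E A σ).2.1.symm
  · have := UniversalCoprimeFactorizationRing.homEquiv_comp_fst _ f.natDegree g.natDegree hn
      (.mk p hp rfl) σ (Algebra.ofId A (ResidueField A))
    rw [hσ] at this
    have h1 : E (ResidueField A) φ = _ := Equiv.apply_symm_apply _ _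
    simp only [E] at h1
    rw [h1] at this
    exact congr(($this).1).symm
  · have := UniversalCoprimeFactorizationRing.homEquiv_comp_snd _ f.natDegree g.natDegree hn
      (.mk p hp rfl) σ (Algebra.ofId A (ResidueField A))
    rw [hσ] at this
    have h1 : E (ResidueField A) φ = _ := Equiv.apply_symm_apply _ _
    simp only [E] at h1
    rw [h1] at this
    exact congr(($this).1).symm

/-- A monic polynomial over a Henselian local ring is a product of coprime polynomials `f` and `g`
such that `f(1)` and `g(0)` are units. -/
theorem exists_coprime_factorization_at_zero {A : Type u} [CommRing A] [HenselianLocalRing A]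
    (p : A[X]) (hp : p.Monic) :
    ∃ f g : A[X], p = f * g ∧ IsCoprime f g ∧ IsUnit (f.eval 1) ∧ IsUnit (g.eval 0) := by
  have hp' := hp.map (residue A)
  -- Split the reduction as `X ^ m * q` with `X ∤ q`: the first factor is `1` at `1`, the second is
  -- nonzero at `0`.
  obtain ⟨q, hq, hq0⟩ := exists_eq_pow_rootMultiplicity_mul_and_not_dvd (p.map (residue A))
    hp'.ne_zero 0
  rw [C_0, sub_zero] at hq hq0
  have hqm : q.Monic := (monic_X_pow _).of_mul_monic_left (hq ▸ hp')
  obtain ⟨f, g, h1, h2, h3, h4⟩ := exists_factorization_of_henselian p hp _ q (monic_X_pow _) hqm hq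
    (((Polynomial.irreducible_X).coprime_iff_not_dvd.mpr hq0).pow_left)
  refine ⟨f, g, h1, h2, (isUnit_map_iff (residue A) _).mp ?_,
    (isUnit_map_iff (residue A) _).mp ?_⟩
  · rw [← eval_map_apply, h3]; simp
  · rw [← eval_map_apply, h4]
    rw [X_dvd_iff, coeff_zero_eq_eval_zero] at hq0
    simpa using hq0

/-- If `p(e) = 0` and `p(c)` is a unit of the base ring, then `c - e` is a unit. -/
theorem isUnit_algebraMap_sub_of_aeval_eq_zero {A B : Type*} [CommRing A] [Ring B] [Algebra A B]
    (p : A[X]) (c : A) (e : B) (he : aeval e p = 0) (hc : IsUnit (p.eval c)) :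
    IsUnit (algebraMap A B c - e) := by
  obtain ⟨q, hq⟩ := X_sub_C_dvd_sub_C_eval (a := c) (p := p)
  have h1 : (algebraMap A B c - e) * aeval e q = algebraMap A B (p.eval c) := by
    have := congr(aeval e $hq)
    simp only [map_sub, he, aeval_C, map_mul, aeval_X, zero_sub] at this
    rw [← neg_inj, this, ← neg_mul, neg_sub]
  have hcomm : Commute (algebraMap A B c - e) (aeval e q) := by
    have : algebraMap A B c - e = aeval e (C c - X) := by simp
    rw [this]
    exact (Commute.all (C c - X) q).map (aeval e)
  exact ((hcomm.isUnit_mul_iff).mp (h1 ▸ hc.map _)).1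

/-- Let `B'` be a finite algebra over a Henselian local ring. If a quotient `B` of `B'` has the
property that all the idempotents of `B'` become trivial in `B`, then `B` is local. -/
theorem isUnit_or_isUnit_one_sub_of_idempotents {A : Type u} [CommRing A] [HenselianLocalRing A]
    {B B' : Type*} [Ring B] [Ring B'] [Algebra A B] [Algebra A B'] [Module.Finite A B']
    (φ : B' →ₐ[A] B) (hφ : Function.Surjective φ)
    (h : ∀ π : B', π * π = π → φ π = 0 ∨ φ (1 - π) = 0) (e : B) :
    IsUnit e ∨ IsUnit (1 - e) := by
  obtain ⟨x, hx⟩ := hφ e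
  obtain ⟨p, hp, hpx⟩ := Algebra.IsIntegral.isIntegral (R := A) x
  obtain ⟨f, g, rfl, ⟨a, b, hab⟩, hf, hg⟩ := exists_coprime_factorization_at_zero p hp
  change aeval x (f * g) = 0 at hpx
  have hfg : aeval e (f * g) = 0 := by rw [← hx, aeval_algHom_apply, hpx, map_zero]
  -- Since `a * f + b * g = 1`, the element `a * f` is idempotent modulo `f * g`, which kills `x`.
  have hidem : aeval x (a * f) * aeval x (a * f) = aeval x (a * f) := by
    rw [← map_mul, ← sub_eq_zero, ← map_sub, show a * f * (a * f) - a * f = -(a * b) * (f * g) by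
      linear_combination (a * f) * hab, map_mul, hpx, mul_zero]
  have key : aeval e f = 0 ∨ aeval e g = 0 := by
    rcases h _ hidem with h | h
    · left
      rw [← aeval_algHom_apply, hx] at h
      rw [show f = f * (a * f) + b * (f * g) by linear_combination -f * hab, map_add,
        map_mul, h, map_mul _ b, hfg, mul_zero, mul_zero, add_zero]
    · right
      rw [← map_one (aeval (R := A) x), ← map_sub, ← aeval_algHom_apply, hx] at h
      rw [show g = g * (1 - a * f) + a * (f * g) by ring, map_add,
        map_mul, h, map_mul _ a, hfg, mul_zero, mul_zero, add_zero]
  rcases key with h | h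
  · right
    simpa using isUnit_algebraMap_sub_of_aeval_eq_zero f 1 e h hf
  · left
    simpa using isUnit_algebraMap_sub_of_aeval_eq_zero g 0 e h hg

end Henselian

/-! ### Closed-fiber dimension and Krull intersection. -/

section FiberRank

open TensorProduct IsLocalRing

variable (A : Type*) [CommRing A] [IsLocalRing A]

/-- The dimension of the closed fiber of a module over a local ring. -/
noncomputable def fiberRank (M : Type*) [AddCommGroup M] [Module A M] : ℕ :=
  Module.finrank (ResidueField A) (ResidueField A ⊗[A] M)

variable {M N : Type*} [AddCommGroup M] [Module A M] [AddCommGroup N] [Module A N]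

theorem fiberRank_pos [Module.Finite A M] [Nontrivial M] : 0 < fiberRank A M := by
  rw [fiberRank, Module.finrank_pos_iff, ← not_subsingleton_iff_nontrivial,
    IsLocalRing.subsingleton_tensorProduct, not_subsingleton_iff_nontrivial]
  infer_instance

theorem fiberRank_prod [Module.Finite A M] [Module.Finite A N] :
    fiberRank A (M × N) = fiberRank A M + fiberRank A N := by
  rw [fiberRank, (TensorProduct.prodRight A (ResidueField A) (ResidueField A) M N).finrank_eq,
    Module.finrank_prod]
  rfl

theorem fiberRank_le_of_surjective [Module.Finite A M] (f : M →ₗ[A] N)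
    (hf : Function.Surjective f) : fiberRank A N ≤ fiberRank A M :=
  (f.baseChange (ResidueField A)).finrank_le_finrank_of_surjective
    (LinearMap.lTensor_surjective _ hf)

/-- A nonzero element of a finite module over a Noetherian local ring is not divisible by all the
powers of a given non-unit. -/
theorem exists_forall_ne_pow_smul [IsNoetherianRing A] [Module.Finite A M] {r : A}
    (hr : r ∈ maximalIdeal A) {x : M} (hx : x ≠ 0) : ∃ n : ℕ, ∀ y : M, x ≠ r ^ n • y := by
  by_contra! h
  refine hx ?_
  rw [← Submodule.mem_bot A, ← Ideal.iInf_pow_smul_eq_bot_of_isLocalRing (maximalIdeal A)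
    (M := M) (Ideal.IsPrime.ne_top inferInstance), Submodule.mem_iInf]
  intro n
  obtain ⟨y, rfl⟩ := h n
  exact Submodule.smul_mem_smul (Ideal.pow_mem_pow hr n) trivial

end FiberRank

/-! ### Morphisms killed by all non-isomorphisms at one end. -/

section AlmostVanishing

variable {C : Type u} [Category.{v} C] [Preadditive C] [HasZeroObject C] [HasShift C ℤ]
  [∀ n : ℤ, (shiftFunctor C n).Additive] [Pretriangulated C]
  {A : Type*} [CommRing A] [Linear A C]

/-- As `s` kills the third object, `s • 𝟙 T.obj₂` factors through `T.mor₁`, which `r` kills. -/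
theorem smul_id_obj₂_eq_zero {T : Triangle C} (hT : T ∈ distTriang C) {r s : A}
    (h₁ : r • 𝟙 T.obj₁ = 0) (h₃ : s • 𝟙 T.obj₃ = 0) : (s * r) • 𝟙 T.obj₂ = 0 := by
  obtain ⟨φ, hφ⟩ := Triangle.coyoneda_exact₂ T hT (s • 𝟙 T.obj₂) (by
    rw [Linear.smul_comp, Category.id_comp, ← Category.comp_id T.mor₂, ← Linear.comp_smul, h₃,
      comp_zero])
  rw [mul_comm, mul_smul, hφ, ← Category.id_comp T.mor₁, ← Linear.comp_smul, ← Linear.smul_comp,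
    h₁, zero_comp, comp_zero]

/-- Taking the two diagonal blocks of an endomorphism is onto, with block-diagonal maps as
preimages. Together with positivity, the rank of `End` drops strictly along nontrivial
decompositions, so decomposing terminates. -/
theorem fiberRank_end_add_le [IsLocalRing A] [∀ X Y : C, Module.Finite A (X ⟶ Y)] {X Y Z : C}
    (e : X ≅ Y ⊞ Z) :
    fiberRank A (Y ⟶ Y) + fiberRank A (Z ⟶ Z) ≤ fiberRank A (X ⟶ X) := by
  rw [← fiberRank_prod]
  refine fiberRank_le_of_surjective A
    (LinearMap.prod
      ((Linear.leftComp A Y (biprod.inl ≫ e.inv)).comp (Linear.rightComp A X (e.hom ≫ biprod.fst)))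
      ((Linear.leftComp A Z (biprod.inr ≫ e.inv)).comp (Linear.rightComp A X (e.hom ≫ biprod.snd))))
    ?_
  rintro ⟨a, b⟩
  refine ⟨e.hom ≫ biprod.map a b ≫ e.inv, ?_⟩
  simp

omit [HasZeroObject C] [HasShift C ℤ] [∀ n : ℤ, (shiftFunctor C n).Additive] [Pretriangulated C] in
theorem fiberRank_end_pos [IsLocalRing A] [∀ X Y : C, Module.Finite A (X ⟶ Y)] {X : C}
    (hX : ¬ IsZero X) : 0 < fiberRank A (X ⟶ X) := by
  have : Nontrivial (X ⟶ X) := ⟨𝟙 X, 0, fun h => hX ((IsZero.iff_id_eq_zero X).mpr h)⟩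
  exact fiberRank_pos A

/-- An object with finite Hom modules has a finite decomposition into indecomposable objects;
this is the corresponding induction principle. -/
theorem induction_indecomposable (A : Type*) [CommRing A] [Linear A C] [IsLocalRing A]
    [∀ X Y : C, Module.Finite A (X ⟶ Y)]
    {P : C → Prop} (zero : ∀ X, IsZero X → P X) (indec : ∀ X, Indecomposable X → P X)
    (biprod : ∀ X Y Z, (X ≅ Y ⊞ Z) → P Y → P Z → P X) (X : C) : P X := by
  induction hn : fiberRank A (X ⟶ X) using Nat.strong_induction_on generalizing X with
  | h n ih =>
    by_cases hX : IsZero X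
    · exact zero X hX
    by_cases hX' : Indecomposable X
    · exact indec X hX'
    obtain ⟨Y, Z, e, hY, hZ⟩ : ∃ Y Z, ∃ _ : X ≅ Y ⊞ Z, ¬ IsZero Y ∧ ¬ IsZero Z := by
      by_contra! h
      exact hX' ⟨hX, fun Y Z e => or_iff_not_imp_left.mpr (h Y Z e)⟩
    have h := fiberRank_end_add_le (A := A) e
    have h1 := fiberRank_end_pos (A := A) hY
    have h2 := fiberRank_end_pos (A := A) hZ
    exact biprod X Y Z e (ih _ (by lia) Y rfl) (ih _ (by lia) Z rfl)

variable (A) [IsLocalRing A] [∀ X Y : C, Module.Finite A (X ⟶ Y)]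

include A in
-- On some indecomposable summand of `D` the restriction of `t` does not compose to zero with `h`,
-- so it is an isomorphism; its inverse gives the section.
theorem exists_section_of_comp_ne_zero {X V : C} {h : X ⟶ V}
    (hh : ∀ D : C, Indecomposable D → ∀ t : D ⟶ X, ¬ IsIso t → t ≫ h = 0)
    {D : C} (t : D ⟶ X) (ht : t ≫ h ≠ 0) : ∃ s : X ⟶ D, s ≫ t = 𝟙 X := by
  refine induction_indecomposable A (P := fun D => ∀ t : D ⟶ X, t ≫ h ≠ 0 → ∃ s : X ⟶ D, s ≫ t = 𝟙 X)
    (fun D hD t ht => ?_) (fun D hD t ht => ?_) (fun D Y Z e hY hZ t ht => ?_) D t ht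
  · exact absurd (hD.eq_of_src _ _) ht
  · have : IsIso t := by
      by_contra hiso
      exact ht (hh D hD t hiso)
    exact ⟨inv t, by simp⟩
  · by_cases h1 : (biprod.inl ≫ e.inv ≫ t) ≫ h = 0
    · by_cases h2 : (biprod.inr ≫ e.inv ≫ t) ≫ h = 0
      · refine absurd ?_ ht
        rw [← cancel_epi e.inv]
        apply biprod.hom_ext' <;> simp only [Category.assoc, comp_zero] at h1 h2 ⊢ <;> assumption
      · obtain ⟨s, hs⟩ := hZ _ h2
        exact ⟨s ≫ biprod.inr ≫ e.inv, by simpa using hs⟩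
    · obtain ⟨s, hs⟩ := hY _ h1
      exact ⟨s ≫ biprod.inl ≫ e.inv, by simpa using hs⟩

include A in
theorem exists_retraction_of_comp_ne_zero {X V : C} {h : X ⟶ V}
    (hh : ∀ D : C, Indecomposable D → ∀ t : V ⟶ D, ¬ IsIso t → h ≫ t = 0)
    {D : C} (t : V ⟶ D) (ht : h ≫ t ≠ 0) : ∃ s : D ⟶ V, t ≫ s = 𝟙 V := by
  refine induction_indecomposable A (P := fun D => ∀ t : V ⟶ D, h ≫ t ≠ 0 → ∃ s : D ⟶ V, t ≫ s = 𝟙 V)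
    (fun D hD t ht => ?_) (fun D hD t ht => ?_) (fun D Y Z e hY hZ t ht => ?_) D t ht
  · exact absurd (hD.eq_of_tgt _ _) ht
  · have : IsIso t := by
      by_contra hiso
      exact ht (hh D hD t hiso)
    exact ⟨inv t, by simp⟩
  · by_cases h1 : h ≫ t ≫ e.hom ≫ biprod.fst = 0
    · by_cases h2 : h ≫ t ≫ e.hom ≫ biprod.snd = 0
      · refine absurd ?_ ht
        rw [← cancel_mono e.hom]
        apply biprod.hom_ext <;> simpa using by assumption
      · obtain ⟨s, hs⟩ := hZ _ h2
        exact ⟨e.hom ≫ biprod.snd ≫ s, by simpa using hs⟩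
    · obtain ⟨s, hs⟩ := hY _ h1
      exact ⟨e.hom ≫ biprod.fst ≫ s, by simpa using hs⟩

variable {A} [IsNoetherianRing A]

/-- If a nonzero morphism `h : X ⟶ V` is killed by all the morphisms to `X` from indecomposable
objects which are not isomorphisms, then `X` and `V` are torsion. -/
theorem exists_pow_smul_id_eq_zero_of_forall_precomp {X V : C} {h : X ⟶ V} (h0 : h ≠ 0)
    (hh : ∀ D : C, Indecomposable D → ∀ t : D ⟶ X, ¬ IsIso t → t ≫ h = 0)
    (hV : ∀ e : V ⟶ V, IsIso e ∨ IsIso (𝟙 V - e)) {r : A} (hr : r ∈ IsLocalRing.maximalIdeal A) :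
    ∃ n : ℕ, r ^ n • 𝟙 X = 0 ∧ r ^ n • 𝟙 V = 0 := by
  obtain ⟨n, hn⟩ := exists_forall_ne_pow_smul A hr h0
  refine ⟨n, ?_, ?_⟩
  · obtain ⟨D, t, δ, hT⟩ := distinguished_cocone_triangle₁ (r ^ n • 𝟙 X)
    -- Otherwise `h` would factor through `r ^ n • 𝟙 X`, that is, be divisible by `r ^ n`.
    have ht : t ≫ h ≠ 0 := fun h1 => by
      obtain ⟨(y : X ⟶ V), (hy : h = (r ^ n • 𝟙 X) ≫ y)⟩ := Triangle.yoneda_exact₂ _ hT h h1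
      exact hn y (by simpa using hy)
    obtain ⟨s, hs⟩ := exists_section_of_comp_ne_zero A hh t ht
    have h1 : t ≫ (r ^ n • 𝟙 X) = 0 := comp_distTriang_mor_zero₁₂ _ hT
    have h2 : (s ≫ t) ≫ (r ^ n • 𝟙 X) = 0 := by rw [Category.assoc, h1, comp_zero]
    rwa [hs, Category.id_comp] at h2
  · obtain ⟨D, t, δ, hT⟩ := distinguished_cocone_triangle (r ^ n • 𝟙 V)
    have ht : h ≫ t ≠ 0 := fun h1 => by
      obtain ⟨(y : X ⟶ V), (hy : h = y ≫ (r ^ n • 𝟙 V))⟩ := Triangle.coyoneda_exact₂ _ hT h h1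
      exact hn y (by simpa using hy)
    have h1 : (r ^ n • 𝟙 V) ≫ t = 0 := comp_distTriang_mor_zero₁₂ _ hT
    -- The hypothesis tests only maps into `X`, so `t` is not known to split. Instead `h` is
    -- recovered from `h ≫ t`: if `g ≫ h ≠ 0`, then `g` would have a section and `h ≫ t` would
    -- vanish.
    obtain ⟨K, g, δ', hT'⟩ := distinguished_cocone_triangle₁ (h ≫ t)
    have hg : g ≫ h = 0 := by
      by_contra hg
      obtain ⟨s, hs⟩ := exists_section_of_comp_ne_zero A hh g hg
      have h2 : g ≫ h ≫ t = 0 := comp_distTriang_mor_zero₁₂ _ hT'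
      exact ht (by rw [← Category.id_comp (h ≫ t), ← hs, Category.assoc, h2, comp_zero])
    obtain ⟨(ρ : D ⟶ V), (hρ : h = (h ≫ t) ≫ ρ)⟩ := Triangle.yoneda_exact₂ _ hT' h hg
    -- As `h ≫ (t ≫ ρ) = h ≠ 0`, the map `𝟙 V - t ≫ ρ` is not invertible; so `t ≫ ρ` is, while `r ^
    -- n` kills it.
    rcases hV (t ≫ ρ) with h3 | h3
    · rw [← cancel_mono (t ≫ ρ), zero_comp, reassoc_of% h1, zero_comp]
    · refine absurd ?_ h0
      rw [← cancel_mono (𝟙 V - t ≫ ρ), zero_comp, Preadditive.comp_sub, ← Category.assoc, ← hρ,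
        Category.comp_id, sub_self]

/-- If a nonzero morphism `h : X ⟶ V` is killed by all the morphisms from `V` to indecomposable
objects which are not isomorphisms, then `X` and `V` are torsion. -/
theorem exists_pow_smul_id_eq_zero_of_forall_postcomp {X V : C} {h : X ⟶ V} (h0 : h ≠ 0)
    (hh : ∀ D : C, Indecomposable D → ∀ t : V ⟶ D, ¬ IsIso t → h ≫ t = 0)
    (hX : ∀ e : X ⟶ X, IsIso e ∨ IsIso (𝟙 X - e)) {r : A} (hr : r ∈ IsLocalRing.maximalIdeal A) :
    ∃ n : ℕ, r ^ n • 𝟙 X = 0 ∧ r ^ n • 𝟙 V = 0 := by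
  obtain ⟨n, hn⟩ := exists_forall_ne_pow_smul A hr h0
  refine ⟨n, ?_, ?_⟩
  · obtain ⟨D, t, δ, hT⟩ := distinguished_cocone_triangle₁ (r ^ n • 𝟙 X)
    have ht : t ≫ h ≠ 0 := fun h1 => by
      obtain ⟨(y : X ⟶ V), (hy : h = (r ^ n • 𝟙 X) ≫ y)⟩ := Triangle.yoneda_exact₂ _ hT h h1
      exact hn y (by simpa using hy)
    have h1 : t ≫ (r ^ n • 𝟙 X) = 0 := comp_distTriang_mor_zero₁₂ _ hT
    -- Dually, the source is now the end without a direct splitting, and `h` is recovered from `t ≫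
    -- h`.
    obtain ⟨K, g, δ', hT'⟩ := distinguished_cocone_triangle (t ≫ h)
    have hg : h ≫ g = 0 := by
      by_contra hg
      obtain ⟨s, hs⟩ := exists_retraction_of_comp_ne_zero A hh g hg
      have h2 : (t ≫ h) ≫ g = 0 := comp_distTriang_mor_zero₁₂ _ hT'
      exact ht (by rw [← Category.comp_id (t ≫ h), ← hs, ← Category.assoc, h2, zero_comp])
    obtain ⟨(ρ : X ⟶ D), (hρ : h = ρ ≫ t ≫ h)⟩ := Triangle.coyoneda_exact₂ _ hT' h hg
    rcases hX (ρ ≫ t) with h3 | h3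
    · rw [← cancel_epi (ρ ≫ t), comp_zero, Category.assoc, h1, comp_zero]
    · refine absurd ?_ h0
      rw [← cancel_epi (𝟙 X - ρ ≫ t), comp_zero, Preadditive.sub_comp, Category.assoc, ← hρ,
        Category.id_comp, sub_self]
  · obtain ⟨D, t, δ, hT⟩ := distinguished_cocone_triangle (r ^ n • 𝟙 V)
    have ht : h ≫ t ≠ 0 := fun h1 => by
      obtain ⟨(y : X ⟶ V), (hy : h = y ≫ (r ^ n • 𝟙 V))⟩ := Triangle.coyoneda_exact₂ _ hT h h1
      exact hn y (by simpa using hy)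
    obtain ⟨s, hs⟩ := exists_retraction_of_comp_ne_zero A hh t ht
    have h1 : (r ^ n • 𝟙 V) ≫ t = 0 := comp_distTriang_mor_zero₁₂ _ hT
    have h2 : (r ^ n • 𝟙 V) ≫ t ≫ s = 0 := by rw [← Category.assoc, h1, zero_comp]
    rwa [hs, Category.comp_id] at h2

end AlmostVanishing

/-! ### Finite length from nilpotent action. -/

section FiniteLength

open IsLocalRing

/-- A finite module over a Noetherian local ring on which every non-unit acts nilpotently has
finite length. -/
theorem isFiniteLength_of_forall_pow_smul_eq_zero {A : Type*} [CommRing A] [IsNoetherianRing A]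
    [IsLocalRing A] {M : Type*} [AddCommGroup M] [Module A M] [Module.Finite A M]
    (h : ∀ r ∈ maximalIdeal A, ∃ n : ℕ, ∀ m : M, r ^ n • m = 0) : IsFiniteLength A M := by
  rw [isFiniteLength_iff_isNoetherian_isArtinian]
  refine ⟨inferInstance, ?_⟩
  -- The exponent may depend on `r`: it suffices that every prime over the annihilator contains the
  -- maximal ideal, so that the Noetherian quotient has dimension zero.
  have : IsArtinianRing (A ⧸ Module.annihilator A M) := by
    rw [isArtinianRing_iff_krullDimLE_zero, Ring.krullDimLE_zero_iff]
    intro P hP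
    have hle : maximalIdeal A ≤ P.comap (Ideal.Quotient.mk _) := fun r hr => by
      obtain ⟨n, hn⟩ := h r hr
      refine (hP.comap (Ideal.Quotient.mk _)).mem_of_pow_mem n ?_
      rw [Ideal.mem_comap, Ideal.Quotient.eq_zero_iff_mem.mpr (Module.mem_annihilator.mpr hn)]
      exact P.zero_mem
    have hmax : (P.comap (Ideal.Quotient.mk (Module.annihilator A M))).IsMaximal := by
      rw [← (maximalIdeal.isMaximal A).eq_of_le (hP.comap _).ne_top hle]
      infer_instance
    rw [← Ideal.map_comap_of_surjective _ Ideal.Quotient.mk_surjective P]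
    exact (Ideal.map_eq_top_or_isMaximal_of_surjective _ Ideal.Quotient.mk_surjective
      hmax).resolve_left (by
        rw [Ideal.map_comap_of_surjective _ Ideal.Quotient.mk_surjective P]
        exact hP.ne_top)
  let : Module (A ⧸ Module.annihilator A M) M := Module.IsTorsionBySet.module
    (I := Module.annihilator A M) (fun m a => Module.mem_annihilator.mp a.2 m)
  have : IsScalarTower A (A ⧸ Module.annihilator A M) M :=
    Module.IsTorsionBySet.isScalarTower _
  have : Module.Finite (A ⧸ Module.annihilator A M) M :=
    Module.Finite.of_restrictScalars_finite A _ _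
  have : IsArtinian (A ⧸ Module.annihilator A M) M := inferInstance
  exact isArtinian_of_surjective_algebraMap (S := A) (R := A ⧸ Module.annihilator A M)
    Ideal.Quotient.mk_surjective

theorem directSum_finite {A : Type*} [CommRing A] {ι : Type*} [DecidableEq ι] (s : Finset ι)
    (M : ι → Type*) [∀ i, AddCommGroup (M i)] [∀ i, Module A (M i)] [∀ i, Module.Finite A (M i)]
    (hs : ∀ i ∉ s, Subsingleton (M i)) : Module.Finite A (DirectSum ι M) := by
  refine ⟨?_⟩
  have : (⊤ : Submodule A (DirectSum ι M)) = ⨆ i ∈ s, LinearMap.range (DirectSum.lof A ι M i) := by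
    refine le_antisymm ?_ le_top
    rw [← DFinsupp.iSup_range_lsingle]
    refine iSup_le fun i => ?_
    by_cases hi : i ∈ s
    · exact le_biSup (fun i => LinearMap.range (DirectSum.lof A ι M i)) hi
    · have := hs i hi
      rintro _ ⟨x, rfl⟩
      rw [Subsingleton.elim x 0, map_zero]
      exact Submodule.zero_mem _
  rw [this]
  refine Submodule.fg_biSup _ _ fun i _ => ?_
  rw [LinearMap.range_eq_map]
  exact Module.Finite.fg_top.map _

end FiniteLength

/-! ### `A`-linearity of cohomology and shifts. -/

section Linear

variable {A : Type u} [CommRing A]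

instance (i : ℤ) :
    (HomologicalComplex.homologyFunctor (ModuleCat.{u} A) (.up ℤ) i).Linear A where
  map_smul f r := ShortComplex.homologyMap_smul
    ((HomologicalComplex.shortComplexFunctor _ _ i).map f) r

instance (i : ℤ) : (HomotopyCategory.homologyFunctor (ModuleCat.{u} A) (.up ℤ) i).Linear A :=
  have := Functor.linear_of_iso A
    (HomotopyCategory.homologyFunctorFactors (ModuleCat.{u} A) (.up ℤ) i).symm
  (HomotopyCategory.quotient _ _).linear_of_full_essSurj_comp _

instance (n : ℤ) : Functor.Linear A (shiftFunctor (Kb A) n) where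
  map_smul f r := by
    have h1 := ((boundedProj A).ι.commShiftIso n).hom.naturality (r • f)
    have h2 := ((boundedProj A).ι.commShiftIso n).hom.naturality f
    dsimp only [Functor.comp_map] at h1 h2
    rw [(boundedProj A).ι.map_smul, (shiftFunctor (HomotopyCategory (ModuleCat.{u} A) (.up ℤ)) n).map_smul, Linear.comp_smul, ← h2,
      ← Linear.smul_comp, cancel_mono, ← (boundedProj A).ι.map_smul] at h1
    exact (boundedProj A).ι.map_injective h1

theorem cohomology_iso_homology (X : Kb A) (i : ℤ) :
    Nonempty (cohomology X i ≅ X.obj.as.homology i) :=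
  ⟨(HomotopyCategory.homologyFunctorFactors _ _ i).app X.obj.as⟩

end Linear

/-! ### Finiteness of Hom modules and cohomology. -/

section Finiteness

variable {A : Type u} [CommRing A] [IsNoetherianRing A]

/-- Chain maps embed in a finite product of termwise Hom modules, each finite over the Noetherian
ring `A`. -/
theorem finite_hom_of_boundedProjComplex {K L : CochainComplex (ModuleCat.{u} A) ℤ}
    (hK : boundedProjComplex A K) (hL : boundedProjComplex A L) : Module.Finite A (K ⟶ L) := by
  obtain ⟨⟨a, b, _, _⟩, hK⟩ := hK
  have hfin : ∀ i, Module.Finite A (K.X i ⟶ L.X i) := fun i => by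
    obtain ⟨_, _⟩ := hK i
    obtain ⟨_, _⟩ := hL.2 i
    exact Module.Finite.equiv (ModuleCat.homLinearEquiv (S := A)).symm
  let φ : (K ⟶ L) →ₗ[A] ((i : Set.Icc a b) → (K.X i ⟶ L.X i)) :=
    { toFun := fun f i => f.f i
      map_add' := fun _ _ => rfl
      map_smul' := fun _ _ => rfl }
  refine Module.Finite.of_injective φ fun f g hfg => ?_
  ext i : 1
  by_cases hi : i ∈ Set.Icc a b
  · exact congr_fun hfg ⟨i, hi⟩
  · rw [Set.mem_Icc, not_and_or, not_le, not_le] at hi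
    rcases hi with hi | hi
    · exact (K.isZero_of_isStrictlyGE a i hi).eq_of_src _ _
    · exact (K.isZero_of_isStrictlyLE b i hi).eq_of_src _ _

instance (X Y : Kb A) : Module.Finite A (X ⟶ Y) := by
  have := finite_hom_of_boundedProjComplex X.property Y.property
  have : Module.Finite A (X.obj ⟶ Y.obj) :=
    Module.Finite.of_surjective ((HomotopyCategory.quotient _ _).mapLinearMap A)
      (HomotopyCategory.quotient (ModuleCat.{u} A) (.up ℤ)).map_surjective
  exact Module.Finite.equiv (InducedCategory.homLinearEquiv (R := A)).symm

theorem finite_homology {K : CochainComplex (ModuleCat.{u} A) ℤ} (hK : boundedProjComplex A K)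
    (i : ℤ) : Module.Finite A (K.homology i) := by
  obtain ⟨_, _⟩ := hK.2 i
  have : Module.Finite A (K.cycles i) :=
    Module.Finite.of_injective (K.iCycles i).hom ((ModuleCat.mono_iff_injective _).mp inferInstance)
  exact Module.Finite.of_surjective (K.homologyπ i).hom
    ((ModuleCat.epi_iff_surjective _).mp inferInstance)

instance (X : Kb A) (i : ℤ) : Module.Finite A (cohomology X i) := by
  obtain ⟨e⟩ := cohomology_iso_homology X i
  have := finite_homology X.property i
  exact Module.Finite.equiv e.symm.toLinearEquiv

instance (X : Kb A) : Module.Finite A (DirectSum ℤ fun i => cohomology X i) := by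
  obtain ⟨⟨a, b, _, _⟩, -⟩ := X.property
  refine directSum_finite (Finset.Icc a b) _ fun i hi => ?_
  obtain ⟨e⟩ := cohomology_iso_homology X i
  have hX : IsZero (X.obj.as.X i) := by
    rw [Finset.mem_Icc, not_and_or, not_le, not_le] at hi
    rcases hi with hi | hi
    · exact CochainComplex.isZero_of_isStrictlyGE _ a i hi
    · exact CochainComplex.isZero_of_isStrictlyLE _ b i hi
  exact ModuleCat.subsingleton_of_isZero
    (((HomologicalComplex.exactAt_iff_isZero_homology _ _).mp
      (HomologicalComplex.ExactAt.of_isZero hX)).of_iso e)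

theorem hasFiniteLengthCohomology_of_forall_pow_smul_id_eq_zero [IsLocalRing A] (X : Kb A)
    (h : ∀ r ∈ IsLocalRing.maximalIdeal A, ∃ n : ℕ, r ^ n • 𝟙 X = 0) :
    HasFiniteLengthCohomology X := by
  refine isFiniteLength_of_forall_pow_smul_eq_zero fun r hr => ?_
  obtain ⟨n, hn⟩ := h r hr
  refine ⟨n, fun m => ?_⟩
  ext i : 1
  have h1 : r ^ n • 𝟙 (cohomology X i) = 0 := by
    have := congr((HomotopyCategory.homologyFunctor _ _ i).map ((boundedProj A).ι.map $hn))
    rwa [Functor.map_smul, Functor.map_smul, CategoryTheory.Functor.map_id, CategoryTheory.Functor.map_id, Functor.map_zero,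
      Functor.map_zero] at this
  exact congr($h1 (m i))

end Finiteness

/-! ### Indecomposables have local endomorphism rings. -/

section Fitting

/-- An idempotent decomposition of an object of a preadditive category gives a biproduct. -/
noncomputable def isoBiprodOfSplittings {C : Type*} [Category C] [Preadditive C]
    [HasBinaryBiproducts C] {X Y Z : C} (i₁ : Y ⟶ X) (q₁ : X ⟶ Y) (i₂ : Z ⟶ X) (q₂ : X ⟶ Z)
    (h₁ : i₁ ≫ q₁ = 𝟙 Y) (h₂ : i₂ ≫ q₂ = 𝟙 Z) (h : q₁ ≫ i₁ + q₂ ≫ i₂ = 𝟙 X) : X ≅ Y ⊞ Z where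
  hom := biprod.lift q₁ q₂
  inv := biprod.desc i₁ i₂
  hom_inv_id := by simpa using h
  inv_hom_id := by
    -- Inserting the identity in the middle gives `i₁ ≫ q₂ = i₁ ≫ q₂ + i₁ ≫ q₂`, so orthogonality
    -- need not be assumed.
    have h12 : i₁ ≫ q₂ = 0 := by
      have : i₁ ≫ (q₁ ≫ i₁ + q₂ ≫ i₂) ≫ q₂ = i₁ ≫ q₂ := by rw [h, Category.id_comp]
      simpa [h₂, reassoc_of% h₁] using this
    have h21 : i₂ ≫ q₁ = 0 := by
      have : i₂ ≫ (q₁ ≫ i₁ + q₂ ≫ i₂) ≫ q₁ = i₂ ≫ q₁ := by rw [h, Category.id_comp]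
      simpa [h₁, reassoc_of% h₂] using this
    apply biprod.hom_ext' <;> apply biprod.hom_ext <;> simp [h₁, h₂, h12, h21]

variable {A : Type u} [CommRing A]

theorem boundedProjComplex_of_retract {K L : CochainComplex (ModuleCat.{u} A) ℤ}
    (hK : boundedProjComplex A K) (i : L ⟶ K) (q : K ⟶ L) (h : i ≫ q = 𝟙 L) :
    boundedProjComplex A L := by
  obtain ⟨⟨a, b, _, _⟩, hK⟩ := hK
  have hn (n : ℤ) : i.f n ≫ q.f n = 𝟙 (L.X n) := by
    rw [← HomologicalComplex.comp_f, h, HomologicalComplex.id_f]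
  have hz (n : ℤ) (hn' : IsZero (K.X n)) : IsZero (L.X n) := by
    rw [IsZero.iff_id_eq_zero, ← hn n, hn'.eq_of_tgt (i.f n) 0, zero_comp]
  refine ⟨⟨a, b, ?_, ?_⟩, fun n => ?_⟩
  · rw [CochainComplex.isStrictlyGE_iff]
    exact fun n hn => hz n (K.isZero_of_isStrictlyGE a n hn)
  · rw [CochainComplex.isStrictlyLE_iff]
    exact fun n hn => hz n (K.isZero_of_isStrictlyLE b n hn)
  · obtain ⟨_, _⟩ := hK n
    have hn' : (q.f n).hom ∘ₗ (i.f n).hom = LinearMap.id := congr(($(hn n)).hom)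
    exact ⟨Module.Finite.of_surjective (q.f n).hom
      (LinearMap.surjective_of_comp_eq_id _ _ hn'), Module.Projective.of_split _ _ hn'⟩

/-- Passage to the homotopy category, on endomorphism algebras of bounded complexes of finitely
generated projectives. -/
noncomputable def endToKb (X : Kb A) : End X.obj.as →ₐ[A] End X where
  toFun x := ObjectProperty.homMk ((HomotopyCategory.quotient _ _).map x)
  map_one' := ObjectProperty.hom_ext _ <| (HomotopyCategory.quotient _ _).map_id _
  map_mul' x y := ObjectProperty.hom_ext _ <| (HomotopyCategory.quotient _ _).map_comp _ _
  map_zero' := ObjectProperty.hom_ext _ <| (HomotopyCategory.quotient _ _).map_zero _ _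
  map_add' x y := ObjectProperty.hom_ext _ <| (HomotopyCategory.quotient _ _).map_add
  commutes' r := by
    refine ObjectProperty.hom_ext _ ?_
    exact ((HomotopyCategory.quotient _ _).map_smul r (𝟙 X.obj.as)).trans
      (congrArg (r • ·) ((HomotopyCategory.quotient _ _).map_id _))

theorem endToKb_surjective (X : Kb A) : Function.Surjective (endToKb X) := fun e => by
  obtain ⟨x, hx⟩ := (HomotopyCategory.quotient _ _).map_surjective e.hom
  exact ⟨x, ObjectProperty.hom_ext _ <| hx⟩

/-- An idempotent chain endomorphism of an indecomposable object of `K^b(proj A)` is homotopic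
to `0` or to the identity. -/
theorem endToKb_eq_zero_or_eq_one {X : Kb A} (hX : Indecomposable X) (π : End X.obj.as)
    (hπ : π * π = π) : endToKb X π = 0 ∨ endToKb X (1 - π) = 0 := by
  -- The splitting takes place among chain complexes, so no splitting of idempotents in the homotopy
  -- category is needed. The summands are termwise retracts, hence stay in `Kb A`.
  obtain ⟨Y, i₁, q₁, h₁, h₁'⟩ := IsIdempotentComplete.idempotents_split X.obj.as π hπ
  obtain ⟨Z, i₂, q₂, h₂, h₂'⟩ := IsIdempotentComplete.idempotents_split X.obj.as (1 - π : End _)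
    (IsIdempotentElem.one_sub hπ)
  let φ {K L : CochainComplex (ModuleCat.{u} A) ℤ} {hK : boundedProjComplex A K}
      {hL : boundedProjComplex A L} (f : K ⟶ L) :
      (⟨(HomotopyCategory.quotient _ _).obj K, hK⟩ : Kb A) ⟶
        ⟨(HomotopyCategory.quotient _ _).obj L, hL⟩ :=
    ObjectProperty.homMk ((HomotopyCategory.quotient _ _).map f)
  let Y' : Kb A := ⟨(HomotopyCategory.quotient _ _).obj Y,
    boundedProjComplex_of_retract X.property i₁ q₁ h₁⟩
  let Z' : Kb A := ⟨(HomotopyCategory.quotient _ _).obj Z,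
    boundedProjComplex_of_retract X.property i₂ q₂ h₂⟩
  let i₁' : Y' ⟶ X := φ i₁
  let q₁' : X ⟶ Y' := φ q₁
  let i₂' : Z' ⟶ X := φ i₂
  let q₂' : X ⟶ Z' := φ q₂
  have hπ₁ : endToKb X π = q₁' ≫ i₁' := by
    rw [← h₁']
    refine ObjectProperty.hom_ext _ ?_
    exact (HomotopyCategory.quotient _ _).map_comp _ _
  have hπ₂ : endToKb X (1 - π) = q₂' ≫ i₂' := by
    rw [← h₂']
    refine ObjectProperty.hom_ext _ ?_
    exact (HomotopyCategory.quotient _ _).map_comp _ _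
  have e : X ≅ Y' ⊞ Z' := by
    refine isoBiprodOfSplittings i₁' q₁' i₂' q₂' ?_ ?_ ?_
    · refine ObjectProperty.hom_ext _ ?_
      refine ((HomotopyCategory.quotient _ _).map_comp _ _).symm.trans ?_
      rw [h₁]
      exact (HomotopyCategory.quotient _ _).map_id _
    · refine ObjectProperty.hom_ext _ ?_
      refine ((HomotopyCategory.quotient _ _).map_comp _ _).symm.trans ?_
      rw [h₂]
      exact (HomotopyCategory.quotient _ _).map_id _
    · rw [← hπ₁, ← hπ₂]
      exact (map_add (endToKb X) _ _).symm.trans (by rw [add_sub_cancel, map_one]; rfl)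
  rcases hX.2 _ _ e with h | h
  · left
    rw [hπ₁, h.eq_of_tgt q₁' 0, zero_comp]
  · right
    rw [hπ₂, h.eq_of_tgt q₂' 0, zero_comp]

/-- The endomorphism ring of an indecomposable object of `K^b(proj A)` is local when `A` is a
Henselian Noetherian local ring. -/
theorem isIso_or_isIso_id_sub [IsNoetherianRing A] [HenselianLocalRing A] {X : Kb A}
    (hX : Indecomposable X) (e : X ⟶ X) : IsIso e ∨ IsIso (𝟙 X - e) := by
  have : Module.Finite A (End X.obj.as) := finite_hom_of_boundedProjComplex X.property X.property
  exact (isUnit_or_isUnit_one_sub_of_idempotents (endToKb X) (endToKb_surjective X)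
    (endToKb_eq_zero_or_eq_one hX) e).imp (isUnit_iff_isIso _).mp (isUnit_iff_isIso _).mp

end Fitting

/-! ### Application to AR-triangles. -/

section Main

variable {A : Type u} [CommRing A]

theorem isIso_or_isIso_id_sub_shift [IsNoetherianRing A] [HenselianLocalRing A] {X : Kb A}
    (hX : Indecomposable X) (n : ℤ) (e : X⟦n⟧ ⟶ X⟦n⟧) : IsIso e ∨ IsIso (𝟙 _ - e) := by
  obtain ⟨e, rfl⟩ := (shiftFunctor (Kb A) n).map_surjective e
  rcases isIso_or_isIso_id_sub hX e with h | h
  · exact .inl inferInstance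
  · right
    rw [← CategoryTheory.Functor.map_id, ← Functor.map_sub]
    infer_instance

theorem smul_id_eq_zero_of_shift {X : Kb A} {n : ℤ} {r : A} (h : r • 𝟙 (X⟦n⟧) = 0) :
    r • 𝟙 X = 0 := by
  apply (shiftFunctor (Kb A) n).map_injective
  rw [Functor.map_smul, CategoryTheory.Functor.map_id, h, Functor.map_zero]

theorem smul_id_shift_eq_zero {X : Kb A} {r : A} (h : r • 𝟙 X = 0) (n : ℤ) :
    r • 𝟙 (X⟦n⟧) = 0 := by
  rw [← CategoryTheory.Functor.map_id, ← Functor.map_smul, h, Functor.map_zero]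

theorem hasFiniteLengthCohomology_of_distinguished [IsNoetherianRing A] [IsLocalRing A]
    {T : Triangle (Kb A)} (hT : T ∈ distTriang (Kb A))
    (h : ∀ r ∈ IsLocalRing.maximalIdeal A, ∃ n : ℕ,
      r ^ n • 𝟙 T.obj₁ = 0 ∧ r ^ n • 𝟙 T.obj₃ = 0) :
    HasFiniteLengthCohomology T.obj₂ := by
  refine hasFiniteLengthCohomology_of_forall_pow_smul_id_eq_zero _ fun r hr => ?_
  obtain ⟨n, h₁, h₃⟩ := h r hr
  exact ⟨n + n, by rw [pow_add]; exact smul_id_obj₂_eq_zero hT h₁ h₃⟩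

theorem IsRightARTriangle.exists_pow_smul_id_eq_zero [IsNoetherianRing A] [HenselianLocalRing A]
    {U K X : Kb A} {f : U ⟶ K} {g : K ⟶ X} {h : X ⟶ U⟦(1 : ℤ)⟧} (H : IsRightARTriangle f g h)
    {r : A} (hr : r ∈ IsLocalRing.maximalIdeal A) :
    ∃ n : ℕ, r ^ n • 𝟙 U = 0 ∧ r ^ n • 𝟙 X = 0 := by
  obtain ⟨n, h₁, h₂⟩ := exists_pow_smul_id_eq_zero_of_forall_precomp H.ne_zero H.comp_eq_zero
    (isIso_or_isIso_id_sub_shift H.indecomposable_left 1) hr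
  exact ⟨n, smul_id_eq_zero_of_shift h₂, h₁⟩

theorem IsLeftARTriangle.exists_pow_smul_id_eq_zero [IsNoetherianRing A] [HenselianLocalRing A]
    {X U K : Kb A} {w : X⟦(-1 : ℤ)⟧ ⟶ U} {f : U ⟶ K} {g : K ⟶ X} (H : IsLeftARTriangle w f g)
    {r : A} (hr : r ∈ IsLocalRing.maximalIdeal A) :
    ∃ n : ℕ, r ^ n • 𝟙 U = 0 ∧ r ^ n • 𝟙 X = 0 := by
  obtain ⟨n, h₁, h₂⟩ := exists_pow_smul_id_eq_zero_of_forall_postcomp H.ne_zero H.comp_eq_zero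
    (isIso_or_isIso_id_sub_shift H.indecomposable_right (-1)) hr
  exact ⟨n, h₂, smul_id_eq_zero_of_shift h₁⟩

end Main

end ARTriangles

theorem theorem1p5 (A : Type u) [CommRing A] [IsNoetherianRing A] [HenselianLocalRing A] :
    (∀ (U K X : ARTriangles.Kb A) (f : U ⟶ K) (g : K ⟶ X) (h : X ⟶ U⟦(1 : ℤ)⟧),
      ARTriangles.IsRightARTriangle f g h →
        ARTriangles.HasFiniteLengthCohomology X ∧ ARTriangles.HasFiniteLengthCohomology U ∧
          ARTriangles.HasFiniteLengthCohomology K) ∧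
    (∀ (X U K : ARTriangles.Kb A) (w : X⟦(-1 : ℤ)⟧ ⟶ U) (f : U ⟶ K) (g : K ⟶ X),
      ARTriangles.IsLeftARTriangle w f g →
        ARTriangles.HasFiniteLengthCohomology X ∧ ARTriangles.HasFiniteLengthCohomology U ∧
          ARTriangles.HasFiniteLengthCohomology K) := by
  refine ⟨fun U K X f g h H => ?_, fun X U K w f g H => ?_⟩
  · have key := fun r hr => H.exists_pow_smul_id_eq_zero (r := r) hr
    exact ⟨ARTriangles.hasFiniteLengthCohomology_of_forall_pow_smul_id_eq_zero _ fun r hr =>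
        (key r hr).imp fun _ h => h.2,
      ARTriangles.hasFiniteLengthCohomology_of_forall_pow_smul_id_eq_zero _ fun r hr =>
        (key r hr).imp fun _ h => h.1,
      ARTriangles.hasFiniteLengthCohomology_of_distinguished H.distinguished key⟩
  · have key := fun r hr => H.exists_pow_smul_id_eq_zero (r := r) hr
    exact ⟨ARTriangles.hasFiniteLengthCohomology_of_forall_pow_smul_id_eq_zero _ fun r hr =>
        (key r hr).imp fun _ h => h.2,
      ARTriangles.hasFiniteLengthCohomology_of_forall_pow_smul_id_eq_zero _ fun r hr =>
        (key r hr).imp fun _ h => h.1,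
      ARTriangles.hasFiniteLengthCohomology_of_distinguished
        -- Rotation puts `K` in the middle; the third object is then `X⟦-1⟧⟦1⟧` rather than `X`,
        -- whence the two shifts.
        (Pretriangulated.rot_of_distTriang _ H.distinguished) fun r hr =>
          (key r hr).imp fun n h => ⟨h.1, ARTriangles.smul_id_shift_eq_zero
            (ARTriangles.smul_id_shift_eq_zero h.2 (-1)) 1⟩⟩
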